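/- Let $b,d\ge 3$ be integers, $n=4(b+d)$, and let $$\mathrm{Br}_n=\langle \sigma_1,\dots,\sigma_{n-1}\mid \sigma_i\sigma_j=\sigma_j\sigma_i\ (|i-j|>1),\ \sigma_i\sigma_{i+1}\sigma_i=\sigma_{i+1}\sigma_i\sigma_{i+1},\ \sigma_1\cdots\sigma_{n-1}\sigma_{n-1}\cdots\sigma_1=1\rangle$$ be the braid group of the sphere with $n$ marked points. Place the marked points in the plane on two horizontal rows, from left to right $D'_{2d},\dots,D'_1,B'_1,\dots,B'_{2b}$ in the upper row and $D''_{2d},\dots,D''_1,B''_1,\dots,B''_{2b}$ in the lower row, the $D$'s to the left and the $B$'s to the right of the imaginary axis. Consider the straight segments $a_i=B'_iB'_{i+1}$, $c_i=B''_iB''_{i+1}$ ($1\le i\le 2b-1$), $b_j=D'_jD'_{j+1}$, $d_j=D''_jD''_{j+1}$ ($1\le j\le 2d-1$), $p_i=B'_iB''_i$ ($1\le i\le 2b$), $q_j=D'_jD''_j$ ($1\le j\le 2d$), $u'=D'_1B'_1$, $u''=D''_1B''_1$, $u=B'_1D''_1$, and let $s$ be the image of $u$ under the positive half-twists on $u'$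 and $u''$ (an arc from $D'_1$ to $B''_1$). For an arc $\tau$ joining two marked points let $\sigma_\tau\in\mathrm{Br}_n$ be the positive half-twist on $\tau$; the full twist on $\tau$ is $\sigma_\tau^2$. Explicitly: number the marked points $1,\dots,n$ in the order $D''_1,\dots,D''_{2d},D'_{2d},\dots,D'_1,B'_1,\dots,B'_{2b},B''_{2b},\dots,B''_1$; then for $k<l$ the half-twist on the segment joining the points number $k$ and $l$ is $(\sigma_{l-1}\cdots\sigma_{k+1})\,\sigma_k\,(\sigma_{l-1}\cdots\sigma_{k+1})^{-1}$, and $\sigma_s=(\sigma_{u'}\sigma_{u''})\,\sigma_u\,(\sigma_{u'}\sigma_{u''})^{-1}$. Let $H\subset\mathrm{Br}_n$ be the (braid monodromy) group generated by $$\sigma_{a_i},\ \sigma_{c_i}\ (1\le i\le 2b-1),\quad \sigma_{b_j},\ \sigma_{d_j}\ (1\le j\le 2d-1),\quad \sigma_{p_{2b}}^2,\ \sigma_{q_{2d}}^2,\ \sigma_s,\ \sigma_{u'}^3,\ \sigma_{u''}^3 .$$ Let $\theta$ be the homomorphism from the fundamental group of the complement of the marked points (based at the origin, between the two rows) to the symmetric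 group $\mathfrak S_4$ that sends a simple loop around $D'_j$, $D''_j$, $B'_i$, $B''_i$ not crossing the imaginary axis to $(12)$, $(34)$, $(13)$, $(24)$ respectively. A full twist $\sigma_\tau^2$ on an arc $\tau$ joining two marked points is called admissible if the values of $\theta$ on the loops around the two end points of $\tau$, taken along $\tau$ from a base point on $\tau$, are disjoint transpositions. Let $\hat H\subset\mathrm{Br}_n$ be the (stabilized braid monodromy) group generated by $H$ and all admissible full twists. Then for all $1\le i\le 2b$ and $1\le j\le 2d$: 1. there is no $\hat h\in\hat H$ with $\hat h\,\sigma_{p_i}=\sigma_{q_j}\,\hat h$; 2. there is no $h\in H$ with $h\,\sigma_{p_i}^2\,h^{-1}=\sigma_{q_j}^2$, and there is not even such an $h$ in $\hat H$. That is, no half-twist (respectively full twist) on an arc $p_i$ is conjugate under the stabilized braid monodromy group, hence under the braid monodromy group, to the half-twist (respectively full twist) on an arc $q_j$. -/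

import Mathlib

namespace BidoubleBraid

/-! ### The braid group of the sphere -/

/-- The defining relators of the braid group of the sphere on `n` strands, in the generators
`σ_1, …, σ_{n-1}`; the element `k : Fin (n - 1)` stands for the index `k + 1`. -/
def sphereBraidRels (n : ℕ) : Set (FreeGroup (Fin (n - 1))) :=
  {r | ∃ i j : Fin (n - 1), (i : ℕ) + 1 < j ∧
      r = (FreeGroup.of i * FreeGroup.of j) * (FreeGroup.of j * FreeGroup.of i)⁻¹} ∪
  {r | ∃ i j : Fin (n - 1), (i : ℕ) + 1 = j ∧
      r = (FreeGroup.of i * FreeGroup.of j * FreeGroup.of i) *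
        (FreeGroup.of j * FreeGroup.of i * FreeGroup.of j)⁻¹} ∪
  {(List.ofFn fun i : Fin (n - 1) => FreeGroup.of i).prod *
      (List.ofFn fun i : Fin (n - 1) => FreeGroup.of i).reverse.prod}

/-- The braid group `Br_n` of the sphere: generators `σ_1, …, σ_{n-1}`, the braid relations, and
`σ_1 ⋯ σ_{n-1} σ_{n-1} ⋯ σ_1 = 1`. -/
abbrev SphereBraid (n : ℕ) : Type := PresentedGroup (sphereBraidRels n)

/-- The generator `σ_k` of `Br_n`, for `1 ≤ k ≤ n - 1` (the value `1` at other `k` is never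
used). -/
def sigma (n k : ℕ) : SphereBraid n :=
  if h : 1 ≤ k ∧ k ≤ n - 1 then PresentedGroup.of ⟨k - 1, by omega⟩ else 1

/-! ### Half-twists on arcs

Put the `n` marked points, numbered `1, …, n`, on the real line from left to right (or, bending
the line to the boundary of a convex polygon, at the vertices of a polygon in clockwise order, its
interior being the region below the line). The generator `σ_k` is the counterclockwise half-twist
on the segment from point `k` to point `k + 1`; a product `g * h` means `h` first, then `g`.
Hence, if `σ_τ` denotes the half-twist on an arc `τ`, then `g * σ_τ * g⁻¹` is the half-twist on the
arc `g(τ)`, and every half-twist on an arc is of the form `g * σ_k * g⁻¹`. -/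

/-- The half-twist on the arc from point `i` to point `j`, for `1 ≤ i < j ≤ n`, that runs below the
points strictly between them, i.e. on the chord from `i` to `j` of the polygon:
`(σ_{j-1} ⋯ σ_{i+1}) σ_i (σ_{j-1} ⋯ σ_{i+1})⁻¹`. -/
def chordTwist (n i j : ℕ) : SphereBraid n :=
  ((List.Ico (i + 1) j).reverse.map (sigma n)).prod * sigma n i *
    (((List.Ico (i + 1) j).reverse.map (sigma n)).prod)⁻¹

/-! ### The marked points and the arcs

There are `4 (b + d)` marked points, on two horizontal rows, from left to right
`D'_{2d}, …, D'_1, B'_1, …, B'_{2b}` (upper row) and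
`D''_{2d}, …, D''_1, B''_1, …, B''_{2b}` (lower row).
They are the vertices of a polygon with interior the region between the two rows, and are numbered
clockwise, starting from `D''_1`:
`D''_1, …, D''_{2d}, D'_{2d}, …, D'_1, B'_1, …, B'_{2b}, B''_{2b}, …, B''_1`. -/

/-- The number of marked points. -/
abbrev numPts (b d : ℕ) : ℕ := 4 * (b + d)

/-- The number of the point `D''_j`, `1 ≤ j ≤ 2d`. -/
def ptD'' (j : ℕ) : ℕ := j

/-- The number of the point `D'_j`, `1 ≤ j ≤ 2d`. -/
def ptD' (d j : ℕ) : ℕ := 4 * d + 1 - j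

/-- The number of the point `B'_i`, `1 ≤ i ≤ 2b`. -/
def ptB' (d i : ℕ) : ℕ := 4 * d + i

/-- The number of the point `B''_i`, `1 ≤ i ≤ 2b`. -/
def ptB'' (b d i : ℕ) : ℕ := numPts b d + 1 - i

/-- Half-twist on the segment `a_i` from `B'_i` to `B'_{i+1}`, `1 ≤ i ≤ 2b - 1`. -/
def twistA (b d i : ℕ) : SphereBraid (numPts b d) :=
  chordTwist (numPts b d) (ptB' d i) (ptB' d (i + 1))

/-- Half-twist on the segment `c_i` from `B''_i` to `B''_{i+1}`, `1 ≤ i ≤ 2b - 1`. -/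
def twistC (b d i : ℕ) : SphereBraid (numPts b d) :=
  chordTwist (numPts b d) (ptB'' b d (i + 1)) (ptB'' b d i)

/-- Half-twist on the segment `b_j` from `D'_j` to `D'_{j+1}`, `1 ≤ j ≤ 2d - 1`. -/
def twistB (b d j : ℕ) : SphereBraid (numPts b d) :=
  chordTwist (numPts b d) (ptD' d (j + 1)) (ptD' d j)

/-- Half-twist on the segment `d_j` from `D''_j` to `D''_{j+1}`, `1 ≤ j ≤ 2d - 1`. -/
def twistD (b d j : ℕ) : SphereBraid (numPts b d) :=
  chordTwist (numPts b d) (ptD'' j) (ptD'' (j + 1))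

/-- Half-twist on the vertical segment `p_i` from `B'_i` to `B''_i`, `1 ≤ i ≤ 2b`. -/
def twistP (b d i : ℕ) : SphereBraid (numPts b d) :=
  chordTwist (numPts b d) (ptB' d i) (ptB'' b d i)

/-- Half-twist on the vertical segment `q_j` from `D'_j` to `D''_j`, `1 ≤ j ≤ 2d`. -/
def twistQ (b d j : ℕ) : SphereBraid (numPts b d) :=
  chordTwist (numPts b d) (ptD'' j) (ptD' d j)

/-- Half-twist on the segment `u'` from `D'_1` to `B'_1`. -/
def twistU' (b d : ℕ) : SphereBraid (numPts b d) :=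
  chordTwist (numPts b d) (ptD' d 1) (ptB' d 1)

/-- Half-twist on the segment `u''` from `D''_1` to `B''_1`. -/
def twistU'' (b d : ℕ) : SphereBraid (numPts b d) :=
  chordTwist (numPts b d) (ptD'' 1) (ptB'' b d 1)

/-- Half-twist on the diagonal segment `u` from `B'_1` to `D''_1`. -/
def twistU (b d : ℕ) : SphereBraid (numPts b d) :=
  chordTwist (numPts b d) (ptD'' 1) (ptB' d 1)

/-- Half-twist on the arc `s`, the image of `u` under the half-twists on `u'` and `u''`. From
`D'_1` the arc `s` passes over `B'_1`, crosses `a_1`, then `p_1`, goes diagonally through the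
middle of the polygon, crosses `q_1`, then `d_1`, and passes under `D''_1` to `B''_1`. -/
def twistS (b d : ℕ) : SphereBraid (numPts b d) :=
  (twistU' b d * twistU'' b d) * twistU b d * (twistU' b d * twistU'' b d)⁻¹

/-! ### The braid monodromy group -/

/-- The generators of the braid monodromy group: the half-twists on `a_i, c_i` (`1 ≤ i ≤ 2b - 1`),
on `b_j, d_j` (`1 ≤ j ≤ 2d - 1`) and on `s`, the full twists on `p_{2b}` and `q_{2d}`, and the
cubes of the half-twists on `u'` and `u''`. -/
def monodromyGenerators (b d : ℕ) : Set (SphereBraid (numPts b d)) :=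
  {x | ∃ i, 1 ≤ i ∧ i ≤ 2 * b - 1 ∧ (x = twistA b d i ∨ x = twistC b d i)} ∪
  {x | ∃ j, 1 ≤ j ∧ j ≤ 2 * d - 1 ∧ (x = twistB b d j ∨ x = twistD b d j)} ∪
  {twistP b d (2 * b) ^ 2, twistQ b d (2 * d) ^ 2, twistS b d,
    twistU' b d ^ 3, twistU'' b d ^ 3}

/-- The braid monodromy group `H`. -/
def monodromyGroup (b d : ℕ) : Subgroup (SphereBraid (numPts b d)) :=
  Subgroup.closure (monodromyGenerators b d)

/-! ### The covering monodromy, admissible full twists, the stabilized group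

Take a base point inside the polygon and for each marked point the loop `γ_k` that goes straight to
the point numbered `k`, once around it counterclockwise, and back. A homomorphism from the
fundamental group of the complement of the marked points to a group `K` is recorded by its values
on `γ_1, …, γ_n`; below, position `k : Fin n` belongs to the point numbered `k + 1`. -/

/-- The left end of the segment `σ_{i+1}` twists, as a position. -/
def leftPos {n : ℕ} (i : Fin (n - 1)) : Fin n := ⟨i, by omega⟩

/-- The right end of the segment `σ_{i+1}` twists, as a position. -/
def rightPos {n : ℕ} (i : Fin (n - 1)) : Fin n := ⟨i + 1, by omega⟩

/-- Precomposition with a generating half-twist, which carries the loops `γ_l, γ_r` at the two ends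
of its segment to `γ_r` and `γ_r⁻¹ γ_l γ_r`. -/
def hurwitzMove {n : ℕ} {K : Type*} [Group K] (i : Fin (n - 1)) : Equiv.Perm (Fin n → K) where
  toFun t := fun k =>
    if k = leftPos i then t (rightPos i)
    else if k = rightPos i then (t (rightPos i))⁻¹ * t (leftPos i) * t (rightPos i)
    else t k
  invFun t := fun k =>
    if k = leftPos i then t (leftPos i) * t (rightPos i) * (t (leftPos i))⁻¹
    else if k = rightPos i then t (leftPos i)
    else t k
  left_inv t := by
    have h : (rightPos i : Fin n) ≠ leftPos i := by simp [leftPos, rightPos, Fin.ext_iff]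
    funext k
    by_cases h1 : k = leftPos i
    · subst h1; simp [h]; group
    · by_cases h2 : k = rightPos i
      · subst h2; simp [h]
      · simp [h1, h2]
  right_inv t := by
    have h : (rightPos i : Fin n) ≠ leftPos i := by simp [leftPos, rightPos, Fin.ext_iff]
    funext k
    by_cases h1 : k = leftPos i
    · subst h1; simp [h]
    · by_cases h2 : k = rightPos i
      · subst h2; simp [h]; group
      · simp [h1, h2]

/-- The right action of braid words on tuples by precomposition: `pullback t (v * w)` is
`pullback (pullback t v) w`. The entry of `pullback t w` at position `k` is the value of the
homomorphism `t` on the image of the loop `γ_{k+1}` under the braid `w`. -/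
def pullback {n : ℕ} {K : Type*} [Group K] (t : Fin n → K) (w : FreeGroup (Fin (n - 1))) :
    Fin n → K :=
  (FreeGroup.lift (fun i => MulOpposite.op (hurwitzMove (K := K) i)) w).unop t

/-- The covering monodromy `θ` of the fourfold cover: `(1 2)` at the points `D'_j`, `(3 4)` at
`D''_j`, `(1 3)` at `B'_i`, `(2 4)` at `B''_i` (the four sheets are `0, 1, 2, 3` here). -/
def coverMonodromy (b d : ℕ) : Fin (numPts b d) → Equiv.Perm (Fin 4) := fun k =>
  if (k : ℕ) < 2 * d then Equiv.swap 2 3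
  else if (k : ℕ) < 4 * d then Equiv.swap 0 1
  else if (k : ℕ) < 4 * d + 2 * b then Equiv.swap 0 2
  else Equiv.swap 1 3

/-- The admissible full twists: the full twists on those arcs for which the covering monodromies
around the two end points, with respect to a base point on the arc, are disjoint transpositions.
The arc is the image, under the braid given by the word `w`, of the segment that `σ_{i+1}`
twists. -/
def admissibleFullTwists (b d : ℕ) : Set (SphereBraid (numPts b d)) :=
  {x | ∃ (w : FreeGroup (Fin (numPts b d - 1))) (i : Fin (numPts b d - 1)),
    Equiv.Perm.Disjoint (pullback (coverMonodromy b d) w (leftPos i))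
      (pullback (coverMonodromy b d) w (rightPos i)) ∧
    x = PresentedGroup.mk _ w * PresentedGroup.of i ^ 2 * (PresentedGroup.mk _ w)⁻¹}

/-- The stabilized braid monodromy group `Ĥ`, generated by `H` and all admissible full twists. -/
def stabilizedMonodromyGroup (b d : ℕ) : Subgroup (SphereBraid (numPts b d)) :=
  Subgroup.closure (monodromyGenerators b d ∪ admissibleFullTwists b d)

end BidoubleBraid

namespace BidoubleBraid

/-! ### The quandle of affine reflections -/

variable {M N : Type} [AddCommGroup M] [AddCommGroup N]

/-- The operation of the quandle of reflections of the affine Weyl group of type `A₂` over `M`: the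
pair `(c, x)` stands for the reflection in the line `ℓ_c = x`, where `ℓ_0 + ℓ_1 + ℓ_2 = 0`, and
`refl q y` is the conjugate of `y` by `q`. -/
def refl (q y : ZMod 3 × M) : ZMod 3 × M :=
  (-q.1 - y.1, if q.1 = y.1 then 2 • q.2 - y.2 else -q.2 - y.2)

theorem refl_of_eq (c : ZMod 3) (x y : M) : refl (c, x) (c, y) = (c, 2 • x - y) := by
  have h : ∀ c : ZMod 3, -c - c = c := by decide
  simp [refl, h]

theorem refl_of_ne {c e : ZMod 3} (h : c ≠ e) (x y : M) :
    refl (c, x) (e, y) = (-c - e, -x - y) := by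
  simp [refl, h]

theorem refl_self (q : ZMod 3 × M) : refl q q = q := by
  obtain ⟨c, x⟩ := q
  rw [refl_of_eq, two_smul, add_sub_cancel_right]

theorem refl_refl (q y : ZMod 3 × M) : refl q (refl q y) = y := by
  obtain ⟨c, x⟩ := q
  obtain ⟨e, y⟩ := y
  by_cases h : c = e
  · subst h
    simp [refl_of_eq]
  · have h1 : ∀ c e : ZMod 3, c ≠ e → c ≠ -c - e := by decide
    rw [refl_of_ne h, refl_of_ne (h1 c e h)]
    simp

theorem refl_distrib (p q y : ZMod 3 × M) :
    refl p (refl q y) = refl (refl p q) (refl p y) := by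
  obtain ⟨c, x⟩ := p
  obtain ⟨e, y'⟩ := q
  obtain ⟨f, z⟩ := y
  have h0 : ∀ c e f : ZMod 3, -c - (-e - f) = -(-c - e) - (-c - f) := by decide
  have h1 : ∀ e f : ZMod 3, e ≠ f → f ≠ -e - f := by decide
  have h2 : ∀ e f : ZMod 3, e ≠ f → e ≠ -e - f := by decide
  have h3 : ∀ c e f : ZMod 3, e ≠ f → c ≠ e → c ≠ f → c = -e - f := by decide
  have h4 : ∀ c : ZMod 3, -c - c = c := by decide
  have h5 : ∀ e f : ZMod 3, e ≠ f → -f - e ≠ f := by decide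
  refine Prod.ext (h0 c e f) ?_
  by_cases hef : e = f
  · subst hef
    by_cases hce : c = e
    · subst hce
      simp [refl, h4]
      abel
    · simp [refl, hce, h4]
      abel
  · by_cases hce : c = e
    · subst hce
      simp [refl, hef, h2 c f hef, h4]
      abel
    · by_cases hcf : c = f
      · subst hcf
        simp [refl, hef, hce, h1 e c hef, h4, h5 e c hef]
        abel
      · simp [refl, hef, hce, hcf, ← h3 c e f hef hce hcf]
        abel

/-- The inner automorphism of the quandle given by `q`. -/
def reflPerm (q : ZMod 3 × M) : Equiv.Perm (ZMod 3 × M) where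
  toFun := refl q
  invFun := refl q
  left_inv := refl_refl q
  right_inv := refl_refl q

theorem reflPerm_apply (q y : ZMod 3 × M) : reflPerm q y = refl q y := rfl

theorem reflPerm_mul_self (q : ZMod 3 × M) : reflPerm q * reflPerm q = 1 :=
  Equiv.ext (refl_refl q)

theorem reflPerm_refl (q y : ZMod 3 × M) :
    reflPerm (refl q y) = reflPerm q * reflPerm y * reflPerm q := by
  ext1 z
  simp only [Equiv.Perm.mul_apply, reflPerm_apply]
  rw [refl_distrib q y, refl_refl]

/-! ### Braid words acting on tuples of reflections -/

/-- The Hurwitz move on the entries at the positions `i` and `i + 1`. -/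
def tupleMove (i : ℕ) : Equiv.Perm (ℕ → ZMod 3 × M) where
  toFun t := fun k =>
    if k = i then t (i + 1) else if k = i + 1 then refl (t (i + 1)) (t i) else t k
  invFun t := fun k =>
    if k = i then refl (t i) (t (i + 1)) else if k = i + 1 then t i else t k
  left_inv t := by
    funext k
    by_cases h1 : k = i
    · subst h1; simp [refl_refl]
    · by_cases h2 : k = i + 1
      · subst h2; simp
      · simp [h1, h2]
  right_inv t := by
    funext k
    by_cases h1 : k = i
    · subst h1; simp
    · by_cases h2 : k = i + 1
      · subst h2; simp [refl_refl]
      · simp [h1, h2]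

theorem tupleMove_apply (i : ℕ) (t : ℕ → ZMod 3 × M) (k : ℕ) :
    tupleMove i t k =
      if k = i then t (i + 1) else if k = i + 1 then refl (t (i + 1)) (t i) else t k := rfl

theorem tupleMove_symm_apply (i : ℕ) (t : ℕ → ZMod 3 × M) (k : ℕ) :
    (tupleMove i).symm t k =
      if k = i then refl (t i) (t (i + 1)) else if k = i + 1 then t i else t k := rfl

/-- The right action of braid words on tuples of reflections. -/
def reflPullback {n : ℕ} (t : ℕ → ZMod 3 × M) (w : FreeGroup (Fin (n - 1))) : ℕ → ZMod 3 × M :=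
  (FreeGroup.lift (fun i : Fin (n - 1) => MulOpposite.op (tupleMove (M := M) i)) w).unop t

variable {n : ℕ}

@[simp]
theorem reflPullback_one (t : ℕ → ZMod 3 × M) :
    reflPullback t (1 : FreeGroup (Fin (n - 1))) = t := by
  simp [reflPullback]

theorem reflPullback_mul (t : ℕ → ZMod 3 × M) (v w : FreeGroup (Fin (n - 1))) :
    reflPullback t (v * w) = reflPullback (reflPullback t v) w := by
  simp [reflPullback]

theorem reflPullback_of (t : ℕ → ZMod 3 × M) (i : Fin (n - 1)) :
    reflPullback t (FreeGroup.of i) = tupleMove i t := by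
  simp [reflPullback]

theorem reflPullback_of_inv (t : ℕ → ZMod 3 × M) (i : Fin (n - 1)) :
    reflPullback t (FreeGroup.of i)⁻¹ = (tupleMove i).symm t := by
  simp [reflPullback]

theorem reflPullback_mul_inv (t : ℕ → ZMod 3 × M) (w : FreeGroup (Fin (n - 1))) :
    reflPullback (reflPullback t w) w⁻¹ = t := by
  rw [← reflPullback_mul, mul_inv_cancel, reflPullback_one]

theorem reflPullback_inv_mul (t : ℕ → ZMod 3 × M) (w : FreeGroup (Fin (n - 1))) :
    reflPullback (reflPullback t w⁻¹) w = t := by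
  rw [← reflPullback_mul, inv_mul_cancel, reflPullback_one]

/-- Quandle homomorphisms commute with the action of braid words. -/
theorem reflPullback_comp (f : ZMod 3 × M → ZMod 3 × N)
    (hf : ∀ q y, f (refl q y) = refl (f q) (f y)) (w : FreeGroup (Fin (n - 1))) :
    ∀ t : ℕ → ZMod 3 × M, reflPullback (f ∘ t) w = f ∘ reflPullback t w := by
  induction w using FreeGroup.induction_on with
  | C1 => simp
  | of i =>
    intro t
    funext k
    simp only [reflPullback_of, tupleMove_apply, Function.comp_apply]
    split_ifs <;> simp [hf]
  | inv_of i _ =>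
    intro t
    funext k
    simp only [reflPullback_of_inv, tupleMove_symm_apply, Function.comp_apply]
    split_ifs <;> simp [hf]
  | mul v w hv hw =>
    intro t
    rw [reflPullback_mul, reflPullback_mul, hv, hw]

theorem reflPullback_congr (w : FreeGroup (Fin (n - 1))) :
    ∀ t t' : ℕ → ZMod 3 × M, (∀ k < n, t k = t' k) →
      ∀ k < n, reflPullback t w k = reflPullback t' w k := by
  induction w using FreeGroup.induction_on with
  | C1 => simp
  | of i =>
    intro t t' h k hk
    have := i.2
    simp only [reflPullback_of, tupleMove_apply]
    rw [h _ hk, h (i : ℕ) (by omega), h ((i : ℕ) + 1) (by omega)]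
  | inv_of i _ =>
    intro t t' h k hk
    have := i.2
    simp only [reflPullback_of_inv, tupleMove_symm_apply]
    rw [h _ hk, h (i : ℕ) (by omega), h ((i : ℕ) + 1) (by omega)]
  | mul v w hv hw =>
    intro t t' h
    simp only [reflPullback_mul]
    exact hw _ _ (hv _ _ h)

/-- The action of braid words on maps into a quandle of reflections is compatible with the action
on tuples in a group. -/
theorem pullback_comp {K : Type*} [Group K] (f : ZMod 3 × M → K)
    (hf : ∀ q y, f (refl q y) = (f q)⁻¹ * f y * f q)
    (hf' : ∀ q y, f (refl q y) = f q * f y * (f q)⁻¹) (w : FreeGroup (Fin (n - 1))) :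
    ∀ t : ℕ → ZMod 3 × M,
      pullback (fun k : Fin n => f (t k)) w = fun k : Fin n => f (reflPullback t w k) := by
  induction w using FreeGroup.induction_on with
  | C1 => simp [pullback]
  | of i =>
    intro t
    funext k
    simp only [reflPullback_of, tupleMove_apply, pullback, FreeGroup.lift_apply_of,
      MulOpposite.unop_op, hurwitzMove, Equiv.coe_fn_mk, leftPos, rightPos, Fin.ext_iff]
    split_ifs <;> simp [hf]
  | inv_of i _ =>
    intro t
    funext k
    simp only [reflPullback_of_inv, tupleMove_symm_apply, pullback, map_inv,
      FreeGroup.lift_apply_of]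
    change (hurwitzMove i).symm _ k = _
    simp only [hurwitzMove, Equiv.coe_fn_symm_mk, leftPos, rightPos, Fin.ext_iff]
    split_ifs <;> simp [hf']
  | mul v w hv hw =>
    intro t
    have h : ∀ s : Fin n → K, pullback s (v * w) = pullback (pullback s v) w := fun s => by
      simp [pullback]
    rw [h, hv, hw, reflPullback_mul]

/-! ### Inner automorphisms -/

variable (M) in
/-- The group of inner automorphisms of the quandle of reflections. -/
def innerGroup : Subgroup (Equiv.Perm (ZMod 3 × M)) :=
  Subgroup.closure (Set.range reflPerm)

theorem reflPerm_mem_innerGroup (q : ZMod 3 × M) : reflPerm q ∈ innerGroup M :=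
  Subgroup.subset_closure ⟨q, rfl⟩

theorem innerGroup_map_refl {g : Equiv.Perm (ZMod 3 × M)} (hg : g ∈ innerGroup M) :
    ∀ q y, g (refl q y) = refl (g q) (g y) := by
  induction hg using Subgroup.closure_induction with
  | mem x hx =>
    obtain ⟨p, rfl⟩ := hx
    exact refl_distrib p
  | one => simp
  | mul x y _ _ hx hy => intro q z; simp [hx, hy]
  | inv x _ hx =>
    intro q y
    apply x.injective
    simp [hx]

/-- Inner automorphisms are affine, with linear part `η = ± 1`. -/
theorem innerGroup_affine {g : Equiv.Perm (ZMod 3 × M)} (hg : g ∈ innerGroup M) :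
    ∃ η : ℤ, (η = 1 ∨ η = -1) ∧ ∃ (κ : ZMod 3) (m : ZMod 3 → M),
      ∀ c y, g (c, y) = (η * c + κ, η • y + m c) := by
  induction hg using Subgroup.closure_induction with
  | mem x hx =>
    obtain ⟨⟨p, x⟩, rfl⟩ := hx
    refine ⟨-1, Or.inr rfl, -p, fun c => if p = c then 2 • x else -x, fun c y => ?_⟩
    rw [reflPerm_apply]
    refine Prod.ext ?_ ?_
    · simp [refl]; ring
    · simp only [refl]
      split_ifs <;> simp <;> abel
  | one => exact ⟨1, Or.inl rfl, 0, 0, by simp⟩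
  | mul x y _ _ hx hy =>
    obtain ⟨η, hη, κ, m, h⟩ := hx
    obtain ⟨η', hη', κ', m', h'⟩ := hy
    refine ⟨η * η', by rcases hη with rfl | rfl <;> rcases hη' with rfl | rfl <;> simp,
      η * κ' + κ, fun c => η • m' c + m (η' * c + κ'), fun c z => ?_⟩
    rw [Equiv.Perm.mul_apply, h', h]
    refine Prod.ext ?_ ?_
    · push_cast; ring
    · simp only [smul_add, mul_smul]; abel
  | inv x _ hx =>
    obtain ⟨η, hη, κ, m, h⟩ := hx
    have h1 : η * η = 1 := by rcases hη with rfl | rfl <;> rfl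
    have h2 : (η : ZMod 3) * η = 1 := by exact_mod_cast congrArg (Int.cast (R := ZMod 3)) h1
    refine ⟨η, hη, -(η * κ), fun c => -(η • m (η * c - η * κ)), fun c y => ?_⟩
    apply x.injective
    rw [Equiv.Perm.coe_inv, Equiv.apply_symm_apply, h]
    refine Prod.ext ?_ ?_
    · simp only [mul_add, ← mul_assoc, mul_neg, h2]; ring
    · change y = η • (η • y + -(η • m (η * c - η * κ))) + m (η * c + -(η * κ))
      rw [smul_add, smul_neg, smul_smul, smul_smul, h1, one_smul, one_smul, sub_eq_add_neg,
        neg_add_cancel_right]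

/-! ### Tuples with trivial product -/

/-- The product of the reflections at the first `k` positions. -/
def tupleProd (t : ℕ → ZMod 3 × M) : ℕ → Equiv.Perm (ZMod 3 × M)
  | 0 => 1
  | k + 1 => tupleProd t k * reflPerm (t k)

theorem tupleProd_congr {t t' : ℕ → ZMod 3 × M} {m : ℕ} (h : ∀ k < m, t k = t' k) :
    tupleProd t m = tupleProd t' m := by
  induction m with
  | zero => rfl
  | succ m ih => rw [tupleProd, tupleProd, ih fun k hk => h k (by omega), h m (by omega)]

theorem tupleProd_tupleMove (t : ℕ → ZMod 3 × M) {i m : ℕ} (h : i + 2 ≤ m) :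
    tupleProd (tupleMove i t) m = tupleProd t m := by
  induction m, h using Nat.le_induction with
  | base =>
    have h1 : tupleProd (tupleMove i t) i = tupleProd t i :=
      tupleProd_congr fun k hk => by
        rw [tupleMove_apply, if_neg (by omega), if_neg (by omega)]
    simp only [tupleProd, h1, tupleMove_apply, if_true, Nat.succ_ne_self, if_false, reflPerm_refl]
    simp only [mul_assoc]
    rw [← mul_assoc (reflPerm (t (i + 1))) (reflPerm (t (i + 1))), reflPerm_mul_self, one_mul]
  | succ m hm ih =>
    rw [tupleProd, tupleProd, ih, tupleMove_apply, if_neg (by omega), if_neg (by omega)]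

theorem tupleProd_reflPullback (w : FreeGroup (Fin (n - 1))) :
    ∀ t : ℕ → ZMod 3 × M, tupleProd (reflPullback t w) n = tupleProd t n := by
  induction w using FreeGroup.induction_on with
  | C1 => simp
  | of i =>
    intro t
    rw [reflPullback_of, tupleProd_tupleMove]
    have := i.2
    omega
  | inv_of i _ =>
    intro t
    have := i.2
    rw [reflPullback_of_inv, ← tupleProd_tupleMove (i := i) _ (by omega), Equiv.apply_symm_apply]
  | mul v w hv hw =>
    intro t
    rw [reflPullback_mul, hw, hv]

/-! ### Words for the generators and for half-twists on chords -/

/-- The word of the generator `σ_k`. -/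
def sigmaWord (n k : ℕ) : FreeGroup (Fin (n - 1)) :=
  if h : 1 ≤ k ∧ k ≤ n - 1 then FreeGroup.of ⟨k - 1, by omega⟩ else 1

/-- The word of the half-twist on a chord. -/
def chordWord (n i j : ℕ) : FreeGroup (Fin (n - 1)) :=
  ((List.Ico (i + 1) j).reverse.map (sigmaWord n)).prod * sigmaWord n i *
    (((List.Ico (i + 1) j).reverse.map (sigmaWord n)).prod)⁻¹

theorem mk_sigmaWord (n k : ℕ) : PresentedGroup.mk (sphereBraidRels n) (sigmaWord n k) =
    sigma n k := by
  unfold sigmaWord sigma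
  split_ifs
  · rfl
  · simp

theorem mk_chordWord (n i j : ℕ) : PresentedGroup.mk (sphereBraidRels n) (chordWord n i j) =
    chordTwist n i j := by
  simp only [chordWord, chordTwist, map_mul, map_inv, map_list_prod, List.map_map, mk_sigmaWord]
  congr 4 <;> funext k <;> exact mk_sigmaWord n k

theorem reflPullback_sigmaWord (t : ℕ → ZMod 3 × M) {k : ℕ} (hk : k + 1 < n) :
    reflPullback t (sigmaWord n (k + 1)) = tupleMove k t := by
  rw [sigmaWord, dif_pos (by omega), reflPullback_of]
  rfl

theorem reflPullback_descending (t : ℕ → ZMod 3 × M) (a : ℕ) {j : ℕ} (haj : a ≤ j) (hj : j < n) :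
    reflPullback t ((List.Ico (a + 1) (j + 1)).reverse.map (sigmaWord n)).prod = fun k =>
      if k = a then t j else if a < k ∧ k ≤ j then refl (t j) (t (k - 1)) else t k := by
  induction j, haj using Nat.le_induction generalizing t with
  | base =>
    funext k
    simp only [List.Ico.self_empty, List.reverse_nil, List.map_nil, List.prod_nil,
      reflPullback_one]
    split_ifs with h1 h2
    · rw [h1]
    · omega
    · rfl
  | succ j haj ih =>
    rw [List.Ico.succ_top (by omega), List.reverse_append, List.reverse_singleton,
      List.singleton_append, List.map_cons, List.prod_cons, reflPullback_mul,
      reflPullback_sigmaWord _ hj, ih _ (by omega)]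
    funext k
    by_cases h1 : k = a
    · simp [h1, tupleMove_apply]
    · by_cases h2 : k = j + 1
      · subst h2
        simp [tupleMove_apply, h1, show a < j + 1 by omega]
      · by_cases h3 : a < k ∧ k ≤ j
        · have h4 : k - 1 ≠ j := by omega
          have h5 : k - 1 ≠ j + 1 := by omega
          have h6 : k ≤ j + 1 := by omega
          simp [tupleMove_apply, h1, h3, h4, h5, h6]
        · have h4 : ¬ (a < k ∧ k ≤ j + 1) := by omega
          have h5 : k ≠ j := by omega
          simp only [tupleMove_apply, h1, h2, h3, h4, h5, if_false]

/-- The half-twist on a chord carries the entries `t_i`, `t_j` at its ends to `t_j` and the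
reflection of `t_i` in `t_j`, and reflects the entries between them in `t_i`, then in `t_j`. -/
def chordMove (i j : ℕ) (t : ℕ → ZMod 3 × M) : ℕ → ZMod 3 × M := fun k =>
  if k = i then t j else if k = j then refl (t j) (t i)
  else if i < k ∧ k < j then refl (t j) (refl (t i) (t k)) else t k

theorem reflPullback_chordWord (t : ℕ → ZMod 3 × M) {i j : ℕ} (hij : i < j) (hj : j < n) :
    reflPullback t (chordWord n (i + 1) (j + 1)) = chordMove i j t := by
  rw [chordWord, reflPullback_mul, reflPullback_mul, reflPullback_sigmaWord _ (by omega)]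
  rw [← reflPullback_mul_inv (chordMove i j t)
    ((List.Ico (i + 1 + 1) (j + 1)).reverse.map (sigmaWord n)).prod]
  congr 1
  rw [reflPullback_descending _ (i + 1) hij hj, reflPullback_descending _ (i + 1) hij hj]
  have hji : j ≠ i := by omega
  funext k
  simp only [tupleMove_apply]
  by_cases h1 : k = i
  · simp [h1, chordMove]
  · by_cases h2 : k = i + 1
    · subst h2
      simp [chordMove, hji]
    · by_cases h3 : i + 1 < k ∧ k ≤ j
      · have h4 : k - 1 ≠ i := by omega
        have h5 : k - 1 ≠ j := by omega
        have h6 : i < k - 1 ∧ k - 1 < j := by omega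
        simp only [chordMove, h1, h2, h3, h4, h5, h6, hji, if_true, if_false, and_self]
        rw [← refl_distrib, refl_refl]
      · have h4 : k ≠ j := by omega
        have h5 : ¬ (i < k ∧ k < j) := by omega
        simp [chordMove, h1, h2, h3, h4, h5]

/-! ### The relators of the sphere braid group -/

theorem reflPullback_ascending (t : ℕ → ZMod 3 × M) {m : ℕ} (hm : m < n) :
    reflPullback t ((List.Ico 1 (m + 1)).map (sigmaWord n)).prod = fun k =>
      if k < m then t (k + 1)
      else if k = m then (tupleProd t (m + 1))⁻¹ (t 0) else t k := by
  induction m with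
  | zero =>
    funext k
    by_cases h : k = 0
    · subst h
      simp only [List.Ico.self_empty, List.map_nil, List.prod_nil, reflPullback_one, lt_irrefl,
        if_false, if_true, tupleProd, zero_add, one_mul]
      rw [Equiv.Perm.eq_inv_iff_eq, reflPerm_apply, refl_self]
    · simp [h]
  | succ m ih =>
    rw [List.Ico.succ_top (by omega), List.map_append, List.prod_append, reflPullback_mul,
      ih (by omega), List.map_singleton, List.prod_singleton, reflPullback_sigmaWord _ hm]
    funext k
    rw [tupleMove_apply]
    by_cases h1 : k = m
    · simp [h1]
    · by_cases h2 : k = m + 1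
      · subst h2
        have h3 : (tupleProd t (m + 1 + 1))⁻¹ (t 0) =
            refl (t (m + 1)) ((tupleProd t (m + 1))⁻¹ (t 0)) := by
          rw [tupleProd, mul_inv_rev, Equiv.Perm.mul_apply, inv_eq_of_mul_eq_one_left
            (reflPerm_mul_self (t (m + 1))), reflPerm_apply]
        simp [h3]
      · by_cases h3 : k < m
        · simp [h1, h2, h3, show k < m + 1 by omega]
        · simp [h1, h2, h3, show ¬ k < m + 1 by omega]

theorem ofFn_of_eq_map_sigmaWord (n : ℕ) :
    (List.ofFn fun i : Fin (n - 1) => FreeGroup.of i) = (List.Ico 1 n).map (sigmaWord n) := by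
  apply List.ext_getElem
  · simp
  · intro k h1 h2
    simp only [List.length_ofFn] at h1
    have h3 : (List.Ico 1 n)[k]'(by simpa using h1) = 1 + k := by
      simp [List.Ico]
    rw [List.getElem_ofFn, List.getElem_map, h3, sigmaWord, dif_pos (by omega)]
    congr 1
    ext
    simp

/-- The word maps every tuple with trivial product to its image under an inner automorphism. -/
def ActsInner (M : Type) [AddCommGroup M] (n : ℕ) (w : FreeGroup (Fin (n - 1))) : Prop :=
  ∀ t : ℕ → ZMod 3 × M, tupleProd t n = 1 →
    ∃ g ∈ innerGroup M, ∀ k < n, reflPullback t w k = g (t k)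

theorem actsInner_of_eq {v w : FreeGroup (Fin (n - 1))}
    (h : ∀ t : ℕ → ZMod 3 × M, reflPullback t v = reflPullback t w) :
    ActsInner M n (v * w⁻¹) := fun t _ =>
  ⟨1, one_mem _, fun k _ => by rw [reflPullback_mul, h, reflPullback_mul_inv]; rfl⟩

theorem actsInner_of_mem_rels {r : FreeGroup (Fin (n - 1))} (hn : 1 ≤ n)
    (hr : r ∈ sphereBraidRels n) : ActsInner M n r := by
  rcases hr with (⟨i, j, hij, rfl⟩ | ⟨i, j, hij, rfl⟩) | hr
  · apply actsInner_of_eq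
    intro t
    simp only [reflPullback_mul, reflPullback_of]
    funext k
    simp only [tupleMove_apply]
    have h1 : (j : ℕ) ≠ i := by omega
    have h2 : (j : ℕ) ≠ i + 1 := by omega
    have h3 : (j : ℕ) + 1 ≠ i := by omega
    by_cases hi : k = i
    · simp [hi, h1.symm, h2.symm, h3.symm]
    · by_cases hi' : k = i + 1
      · simp [hi', h1.symm, h2.symm, h3.symm]
      · by_cases hj : k = j
        · simp [hj, h1, h2, h3]
        · by_cases hj' : k = j + 1
          · simp [hj', h1, h2, h3]
          · simp [hi, hi', hj, hj']
  · apply actsInner_of_eq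
    intro t
    simp only [reflPullback_mul, reflPullback_of, ← hij]
    funext k
    simp only [tupleMove_apply]
    have h4 : (i : ℕ) + 1 + 1 ≠ i := by omega
    by_cases h1 : k = i
    · simp [h1, h4, h4.symm]
    · by_cases h2 : k = i + 1
      · simp [h2, h4, h4.symm]
      · by_cases h3 : k = i + 2
        · simp [h3, add_assoc, ← refl_distrib]
        · simp [h1, h2, h3, add_assoc]
  · rw [Set.mem_singleton_iff.mp hr]
    intro t ht
    refine ⟨reflPerm (t 0), reflPerm_mem_innerGroup _, fun k hk => ?_⟩
    obtain ⟨m, rfl⟩ : ∃ m, n = m + 1 := ⟨n - 1, by omega⟩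
    rw [ofFn_of_eq_map_sigmaWord, ← List.map_reverse, reflPullback_mul,
      reflPullback_ascending t (Nat.lt_succ_self m),
      reflPullback_descending _ 0 (Nat.zero_le m) (Nat.lt_succ_self m), ht, reflPerm_apply]
    by_cases h : k = 0
    · simp [h, refl_self]
    · have h1 : k - 1 < m := by omega
      have h2 : 0 < k ∧ k ≤ m := by omega
      simp [h, h1, h2, show k - 1 + 1 = k by omega]

theorem actsInner_of_mem_normalClosure {w : FreeGroup (Fin (n - 1))} (hn : 1 ≤ n)
    (hw : w ∈ Subgroup.normalClosure (sphereBraidRels n)) : ActsInner M n w := by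
  induction hw using Subgroup.closure_induction with
  | mem x hx =>
    rw [Group.mem_conjugatesOfSet_iff] at hx
    obtain ⟨r, hr, hc⟩ := hx
    obtain ⟨u, rfl⟩ := isConj_iff.mp hc
    intro t ht
    obtain ⟨g, hg, h⟩ := actsInner_of_mem_rels (M := M) hn hr (reflPullback t u)
      (by rw [tupleProd_reflPullback, ht])
    refine ⟨g, hg, fun k hk => ?_⟩
    rw [reflPullback_mul, reflPullback_mul, reflPullback_congr u⁻¹ _ (g ∘ reflPullback t u) h k hk,
      reflPullback_comp _ (innerGroup_map_refl hg), reflPullback_mul_inv]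
    rfl
  | one => exact fun t _ => ⟨1, one_mem _, by simp⟩
  | mul x y _ _ hx hy =>
    intro t ht
    obtain ⟨g, hg, h⟩ := hx t ht
    obtain ⟨g', hg', h'⟩ := hy t ht
    refine ⟨g * g', mul_mem hg hg', fun k hk => ?_⟩
    rw [reflPullback_mul, reflPullback_congr y _ (g ∘ t) h k hk,
      reflPullback_comp _ (innerGroup_map_refl hg), Function.comp_apply, h' k hk]
    rfl
  | inv x _ hx =>
    intro t ht
    obtain ⟨g, hg, h⟩ := hx (reflPullback t x⁻¹) (by rw [tupleProd_reflPullback, ht])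
    refine ⟨g⁻¹, inv_mem hg, fun k hk => ?_⟩
    have := h k hk
    rw [reflPullback_inv_mul] at this
    rw [this, Equiv.Perm.coe_inv, Equiv.symm_apply_apply]

theorem reflPullback_chordWord' (t : ℕ → ZMod 3 × M) {i j : ℕ} (hi : 1 ≤ i) (hij : i < j)
    (hj : j ≤ n) : reflPullback t (chordWord n i j) = chordMove (i - 1) (j - 1) t := by
  have h := reflPullback_chordWord (n := n) t (i := i - 1) (j := j - 1) (by omega) (by omega)
  rwa [Nat.sub_add_cancel hi, Nat.sub_add_cancel (by omega)] at h

theorem refl_comm {q y : ZMod 3 × M} (h : q.1 ≠ y.1) : refl q y = refl y q := by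
  simp only [refl, if_neg h, if_neg h.symm]
  refine Prod.ext ?_ ?_ <;> simp only <;> abel

theorem chordMove_cube (t : ℕ → ZMod 3 × M) {i j : ℕ} (hij : i < j) (h : (t i).1 ≠ (t j).1) :
    chordMove i j (chordMove i j (chordMove i j t)) = t := by
  have h1 : refl (refl (t j) (t i)) (t j) = t i := by
    have h2 : ∀ c e : ZMod 3, c ≠ e → -e - c ≠ e := by decide
    rw [refl_comm (h2 _ _ h), refl_refl]
  have h3 : refl (t i) (refl (t j) (t i)) = t j := by
    rw [refl_comm h.symm, refl_refl]
  have hji : j ≠ i := by omega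
  funext k
  by_cases hk : k = i
  · simp [chordMove, hk, hji, h1]
  · by_cases hk' : k = j
    · simp [chordMove, hk', hji, h1, h3]
    · by_cases hk'' : i < k ∧ k < j
      · simp [chordMove, hk, hk', hk'', hji, h1, refl_refl]
      · simp [chordMove, hk, hk', hk'']

theorem chordMove_succ (t : ℕ → ZMod 3 × M) (i : ℕ) :
    chordMove i (i + 1) t = tupleMove i t := by
  funext k
  rw [tupleMove_apply, chordMove, if_neg (show ¬ (i < k ∧ k < i + 1) by omega)]

theorem refl_zmod_two {q y : ZMod 3 × ZMod 2} (h : q.1 = y.1) : refl q y = y := by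
  revert q y; decide

theorem tupleMove_sq (t : ℕ → ZMod 3 × ZMod 2) {i : ℕ} (h : (t i).1 = (t (i + 1)).1) :
    tupleMove i (tupleMove i t) = t := by
  funext k
  by_cases hk : k = i
  · simp [tupleMove_apply, hk, refl_zmod_two h.symm]
  · by_cases hk' : k = i + 1
    · simp [tupleMove_apply, hk', refl_zmod_two h.symm, refl_zmod_two h]
    · simp [tupleMove_apply, hk, hk']

/-! ### The invariant quadratic form -/

/-- The direction of the reflections at position `k`. -/
def posType (d k : ℕ) : ZMod 3 := if k < 4 * d then 0 else 1

/-- The tuple of reflections with the directions `posType` and the coordinates `x`. -/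
def lineTuple (d : ℕ) (x : ℕ → M) : ℕ → ZMod 3 × M := fun k => (posType d k, x k)

/-- The weight is `3` at the points `B'_i` and `1` at all others. -/
def weight (b d k : ℕ) : ZMod 4 := if 4 * d ≤ k ∧ k < 4 * d + 2 * b then 3 else 1

/-- The quadratic form, with values in `ℤ/4`, on the coordinates modulo `2`. -/
def quadForm (b d : ℕ) (x : ℕ → ZMod 2) : ZMod 4 :=
  ∑ k ∈ Finset.range (numPts b d), weight b d k * ((x k).val : ZMod 4)

theorem quadForm_eq_of_eqOn_compl (b d : ℕ) {x y : ℕ → ZMod 2} (s : Finset ℕ)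
    (hs : s ⊆ Finset.range (numPts b d)) (h : ∀ k ∉ s, y k = x k)
    (hsum : ∑ k ∈ s, weight b d k * ((y k).val : ZMod 4) =
      ∑ k ∈ s, weight b d k * ((x k).val : ZMod 4)) : quadForm b d y = quadForm b d x := by
  rw [quadForm, quadForm, ← Finset.sum_sdiff hs, ← Finset.sum_sdiff hs, hsum]
  congr 1
  exact Finset.sum_congr rfl fun k hk => by rw [h k (Finset.mem_sdiff.mp hk).2]

theorem map_refl_addMonoidHom (f : M →+ N) (q y : ZMod 3 × M) :
    Prod.map id f (refl q y) = refl (Prod.map id f q) (Prod.map id f y) := by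
  simp only [refl, id_eq, Prod.map]
  split_ifs <;> simp

theorem reflPullback_map (f : M →+ N) (t : ℕ → ZMod 3 × M) (w : FreeGroup (Fin (n - 1))) :
    reflPullback (Prod.map id f ∘ t) w = Prod.map id f ∘ reflPullback t w :=
  reflPullback_comp _ (map_refl_addMonoidHom f) w t

theorem fst_reflPullback {t : ℕ → ZMod 3 × M} {t' : ℕ → ZMod 3 × N}
    (h : ∀ k, (t k).1 = (t' k).1) (w : FreeGroup (Fin (n - 1))) (k : ℕ) :
    (reflPullback t w k).1 = (reflPullback t' w k).1 := by
  have h1 := congrFun (reflPullback_map (0 : M →+ Unit) t w) k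
  have h2 := congrFun (reflPullback_map (0 : N →+ Unit) t' w) k
  have h3 : Prod.map id (0 : M →+ Unit) ∘ t = Prod.map id (0 : N →+ Unit) ∘ t' :=
    funext fun k => Prod.ext (h k) rfl
  rw [h3, h2] at h1
  exact (congrArg Prod.fst h1).symm

theorem fst_reflPullback_lineTuple (d : ℕ) (x : ℕ → M) (y : ℕ → N) (w : FreeGroup (Fin (n - 1)))
    (k : ℕ) : (reflPullback (lineTuple d x) w k).1 = (reflPullback (lineTuple d y) w k).1 :=
  fst_reflPullback (t := lineTuple d x) (t' := lineTuple d y) (fun _ => rfl) w k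

/-- The words that preserve the directions `posType` and the quadratic form. -/
def formStabilizer (b d : ℕ) : Subgroup (FreeGroup (Fin (numPts b d - 1))) where
  carrier := {w | reflPullback (lineTuple d (0 : ℕ → Unit)) w = lineTuple d 0 ∧
    ∀ x y : ℕ → ZMod 2, reflPullback (lineTuple d x) w = lineTuple d y →
      quadForm b d y = quadForm b d x}
  one_mem' := by
    refine ⟨reflPullback_one _, fun x y h => ?_⟩
    rw [reflPullback_one] at h
    congr 1
    exact funext fun k => (congrArg Prod.snd (congrFun h k)).symm
  mul_mem' := by
    rintro v w ⟨hv, hv'⟩ ⟨hw, hw'⟩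
    refine ⟨by rw [reflPullback_mul, hv, hw], fun x y h => ?_⟩
    have h1 : reflPullback (lineTuple d x) v =
        lineTuple d fun k => (reflPullback (lineTuple d x) v k).2 := by
      funext k
      refine Prod.ext ?_ rfl
      rw [fst_reflPullback_lineTuple d x (0 : ℕ → Unit), hv]
      rfl
    rw [reflPullback_mul, h1] at h
    rw [hw' _ _ h, hv' _ _ h1]
  inv_mem' := by
    rintro w ⟨hw, hw'⟩
    refine ⟨?_, fun x y h => ?_⟩
    · conv_lhs => rw [← hw]
      exact reflPullback_mul_inv _ _
    · refine (hw' y x ?_).symm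
      rw [← h, reflPullback_inv_mul]

theorem exists_lineTuple {b d : ℕ} {w : FreeGroup (Fin (numPts b d - 1))}
    (hw : w ∈ formStabilizer b d) (x : ℕ → M) :
    ∃ y : ℕ → M, reflPullback (lineTuple d x) w = lineTuple d y := by
  refine ⟨fun k => (reflPullback (lineTuple d x) w k).2, funext fun k => Prod.ext ?_ rfl⟩
  rw [fst_reflPullback_lineTuple d x (0 : ℕ → Unit), hw.1]
  rfl

theorem mem_formStabilizer {b d : ℕ} {w : FreeGroup (Fin (numPts b d - 1))}
    (h : ∀ x : ℕ → ZMod 2, ∃ y, reflPullback (lineTuple d x) w = lineTuple d y ∧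
      quadForm b d y = quadForm b d x) : w ∈ formStabilizer b d := by
  refine ⟨funext fun k => Prod.ext ?_ rfl, fun x y hxy => ?_⟩
  · obtain ⟨y, hy, -⟩ := h 0
    rw [fst_reflPullback_lineTuple d _ (0 : ℕ → ZMod 2), hy]
    rfl
  · obtain ⟨z, hz, hz'⟩ := h x
    rw [← hz']
    congr 1
    rw [hxy] at hz
    exact funext fun k => congrArg Prod.snd (congrFun hz k)

theorem mem_formStabilizer_of_fixes {b d : ℕ} {w : FreeGroup (Fin (numPts b d - 1))}
    (h : ∀ x : ℕ → ZMod 2, reflPullback (lineTuple d x) w = lineTuple d x) :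
    w ∈ formStabilizer b d :=
  mem_formStabilizer fun x => ⟨x, h x, rfl⟩

/-! ### The generators preserve the form -/

theorem chordWord_mem_formStabilizer {b d i : ℕ} (hi : 1 ≤ i) (hin : i + 1 ≤ numPts b d)
    (ht : posType d (i - 1) = posType d i) (hw : weight b d (i - 1) = weight b d i) :
    chordWord (numPts b d) i (i + 1) ∈ formStabilizer b d := by
  obtain ⟨i, rfl⟩ : ∃ k, i = k + 1 := ⟨i - 1, by omega⟩
  rw [Nat.add_sub_cancel] at ht hw
  refine mem_formStabilizer fun x =>
    ⟨fun k => if k = i then x (i + 1) else if k = i + 1 then x i else x k, ?_, ?_⟩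
  · rw [reflPullback_chordWord' _ hi (by omega) hin]
    simp only [Nat.add_sub_cancel, chordMove_succ]
    funext k
    simp only [tupleMove_apply, lineTuple]
    rw [refl_zmod_two ht.symm]
    split_ifs with h1 h2
    · rw [h1, ht]
    · rw [h2, ht]
    · rfl
  · refine quadForm_eq_of_eqOn_compl b d {i, i + 1} ?_ ?_ ?_
    · intro k hk
      simp only [Finset.mem_insert, Finset.mem_singleton] at hk
      rw [Finset.mem_range]
      omega
    · intro k hk
      simp only [Finset.mem_insert, Finset.mem_singleton, not_or] at hk
      simp [hk.1, hk.2]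
    · rw [Finset.sum_pair (by omega), Finset.sum_pair (by omega)]
      simp [hw, add_comm]

theorem chordWord_sq_mem_formStabilizer {b d i : ℕ} (hi : 1 ≤ i) (hin : i + 1 ≤ numPts b d)
    (ht : posType d (i - 1) = posType d i) :
    chordWord (numPts b d) i (i + 1) ^ 2 ∈ formStabilizer b d := by
  obtain ⟨i, rfl⟩ : ∃ k, i = k + 1 := ⟨i - 1, by omega⟩
  rw [Nat.add_sub_cancel] at ht
  refine mem_formStabilizer_of_fixes fun x => ?_
  rw [pow_two, reflPullback_mul, reflPullback_chordWord' _ hi (by omega) hin,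
    reflPullback_chordWord' _ hi (by omega) hin]
  simp only [Nat.add_sub_cancel, chordMove_succ]
  exact tupleMove_sq _ ht

theorem chordWord_cube_mem_formStabilizer {b d i j : ℕ} (hi : 1 ≤ i) (hij : i < j)
    (hj : j ≤ numPts b d) (ht : posType d (i - 1) ≠ posType d (j - 1)) :
    chordWord (numPts b d) i j ^ 3 ∈ formStabilizer b d := by
  refine mem_formStabilizer_of_fixes fun x => ?_
  rw [pow_three, reflPullback_mul, reflPullback_mul, reflPullback_chordWord' _ hi hij hj,
    reflPullback_chordWord' _ hi hij hj, reflPullback_chordWord' _ hi hij hj]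
  exact chordMove_cube _ (by omega) ht

/-- The transposition in `𝔖₄` that corresponds to a reflection modulo `2`. -/
def reflSwap (q : ZMod 3 × ZMod 2) : Equiv.Perm (Fin 4) :=
  if q.1 = 0 then (if q.2 = 0 then Equiv.swap 2 3 else Equiv.swap 0 1)
  else if q.1 = 1 then (if q.2 = 0 then Equiv.swap 0 2 else Equiv.swap 1 3)
  else (if q.2 = 0 then Equiv.swap 0 3 else Equiv.swap 1 2)

theorem reflSwap_refl (q y : ZMod 3 × ZMod 2) :
    reflSwap (refl q y) = (reflSwap q)⁻¹ * reflSwap y * reflSwap q := by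
  revert q y; decide

theorem reflSwap_inv (q : ZMod 3 × ZMod 2) : (reflSwap q)⁻¹ = reflSwap q := by
  revert q; decide

theorem fst_eq_of_disjoint {q y : ZMod 3 × ZMod 2}
    (h : Equiv.Perm.Disjoint (reflSwap q) (reflSwap y)) : q.1 = y.1 := by
  revert q y; unfold Equiv.Perm.Disjoint; decide

theorem coverMonodromy_eq (b d : ℕ) : coverMonodromy b d = fun k : Fin (numPts b d) =>
    reflSwap (lineTuple d
      (fun k => if k < 2 * d ∨ (4 * d ≤ k ∧ k < 4 * d + 2 * b) then (0 : ZMod 2) else 1) k) := by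
  funext k
  simp only [coverMonodromy, lineTuple, posType, reflSwap]
  by_cases h1 : (k : ℕ) < 2 * d
  · simp [h1, show (k : ℕ) < 4 * d by omega]
  · by_cases h2 : (k : ℕ) < 4 * d
    · simp [h1, h2, show ¬ (4 * d ≤ (k : ℕ)) by omega]
    · by_cases h3 : (k : ℕ) < 4 * d + 2 * b
      · simp [h1, h2, h3, show (4 * d ≤ (k : ℕ)) by omega]
      · simp [h1, h2, h3]

theorem admissible_mem_formStabilizer {b d : ℕ} (w : FreeGroup (Fin (numPts b d - 1)))
    (i : Fin (numPts b d - 1))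
    (h : Equiv.Perm.Disjoint (pullback (coverMonodromy b d) w (leftPos i))
      (pullback (coverMonodromy b d) w (rightPos i))) :
    w * FreeGroup.of i ^ 2 * w⁻¹ ∈ formStabilizer b d := by
  rw [coverMonodromy_eq, pullback_comp _ reflSwap_refl
    (fun q y => by rw [reflSwap_refl, reflSwap_inv])] at h
  have h1 := fst_eq_of_disjoint h
  refine mem_formStabilizer_of_fixes fun x => ?_
  rw [reflPullback_mul, reflPullback_mul, pow_two, reflPullback_mul, reflPullback_of,
    reflPullback_of, tupleMove_sq, reflPullback_mul_inv]
  exact (fst_reflPullback_lineTuple d _ _ w _).trans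
    (h1.trans (fst_reflPullback_lineTuple d _ _ w _))

/-! ### The half-twist on the arc `s` -/

/-- The action of the half-twists on `u'` and `u''`, modulo `2`. -/
theorem chordMove_chordMove_lineTuple {d l : ℕ} (hd : 1 ≤ d) (hl : 4 * d < l)
    (x : ℕ → ZMod 2) (k : ℕ) :
    chordMove 0 l (chordMove (4 * d - 1) (4 * d) (lineTuple d x)) k =
      if k = 0 then (1, x l)
      else if k < 4 * d - 1 then (2, x l + x k)
      else if k = 4 * d - 1 then (0, x 0 + x (4 * d) + x l)
      else if k = 4 * d then (1, x 0 + x (4 * d - 1) + x (4 * d))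
      else if k < l then (0, x 0 + x l + x k)
      else if k = l then (2, x 0 + x l)
      else (1, x k) := by
  have e0 : chordMove (4 * d - 1) (4 * d) (lineTuple d x) 0 = (0, x 0) := by
    simp only [chordMove, lineTuple, posType]
    rw [if_neg (by omega), if_neg (by omega), if_neg (by omega), if_pos (by omega)]
  have el : chordMove (4 * d - 1) (4 * d) (lineTuple d x) l = (1, x l) := by
    simp only [chordMove, lineTuple, posType]
    rw [if_neg (by omega), if_neg (by omega), if_neg (by omega), if_neg (by omega)]
  have em : chordMove (4 * d - 1) (4 * d) (lineTuple d x) (4 * d - 1) = (1, x (4 * d)) := by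
    simp [chordMove, lineTuple, posType]
  have em' : chordMove (4 * d - 1) (4 * d) (lineTuple d x) (4 * d) =
      refl (1, x (4 * d)) (0, x (4 * d - 1)) := by
    simp only [chordMove, lineTuple, posType]
    rw [if_neg (by omega), if_pos trivial, if_neg (by omega), if_pos (by omega)]
  have h1 : ∀ p q r : ZMod 2, refl (1, p) (refl (0, q) (0, r)) = (2, p + r) := by decide
  have h2 : ∀ p q r : ZMod 2, refl (1, p) (refl (0, q) (1, r)) = (0, q + r + p) := by decide
  have h3 : ∀ p q r s : ZMod 2,
    refl (1, p) (refl (0, q) (refl (1, r) (0, s))) = (1, q + s + r) := by decide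
  have h4 : ∀ p q : ZMod 2, refl (1, p) (0, q) = (2, q + p) := by decide
  rw [chordMove, e0, el]
  by_cases c1 : k = 0
  · rw [if_pos c1, if_pos c1]
  rw [if_neg c1, if_neg c1]
  by_cases c2 : k < 4 * d - 1
  · rw [if_neg (by omega), if_pos (by omega), if_pos c2, chordMove, if_neg (by omega),
      if_neg (by omega), if_neg (by omega), lineTuple, posType, if_pos (by omega), h1]
  rw [if_neg c2]
  by_cases c3 : k = 4 * d - 1
  · rw [if_neg (by omega), if_pos (by omega), if_pos c3, c3, em, h2]
  rw [if_neg c3]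
  by_cases c4 : k = 4 * d
  · rw [if_neg (by omega), if_pos (by omega), if_pos c4, c4, em', h3]
  rw [if_neg c4]
  have hk : chordMove (4 * d - 1) (4 * d) (lineTuple d x) k = (1, x k) := by
    rw [chordMove, if_neg c3, if_neg c4, if_neg (by omega), lineTuple, posType,
      if_neg (by omega)]
  rw [hk]
  by_cases c5 : k < l
  · rw [if_neg (by omega), if_pos (by omega), if_pos c5, h2, add_right_comm]
  rw [if_neg c5]
  by_cases c6 : k = l
  · rw [if_pos c6, if_pos c6, h4]
  · rw [if_neg c6, if_neg c6, if_neg (by omega)]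

/-- The half-twist on `s` acts modulo `2` as a transvection. -/
theorem chordMove_lineTuple_transvection {d l : ℕ} (hd : 1 ≤ d) (hl : 4 * d < l) (x y : ℕ → ZMod 2)
    (hy : ∀ k, y k = if k = 0 ∨ k = 4 * d - 1 ∨ k = 4 * d ∨ k = l then
      x k + (x 0 + x (4 * d - 1) + x (4 * d) + x l) else x k) :
    chordMove 0 (4 * d) (chordMove 0 l (chordMove (4 * d - 1) (4 * d) (lineTuple d x))) =
      chordMove 0 l (chordMove (4 * d - 1) (4 * d) (lineTuple d y)) := by
  have y0 := hy 0
  have y1 := hy (4 * d - 1)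
  have y2 := hy (4 * d)
  have yl := hy l
  rw [if_pos (by omega)] at y0 y1 y2 yl
  have v0 := chordMove_chordMove_lineTuple hd hl x 0
  have vm := chordMove_chordMove_lineTuple hd hl x (4 * d)
  rw [if_pos rfl] at v0
  rw [if_neg (by omega), if_neg (by omega), if_neg (by omega), if_pos rfl] at vm
  have z1 : ∀ p q r s : ZMod 2, p + q + r = s + (p + q + r + s) := by decide
  have z2 : ∀ p q r s t : ZMod 2,
    refl (1, p + q + r) (refl (1, s) (2, s + t)) = (2, s + (p + q + r + s) + t) := by decide
  have z3 : ∀ p q r s : ZMod 2, refl (1, p + q + r) (refl (1, s) (0, p + r + s)) =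
    (0, p + (p + q + r + s) + (r + (p + q + r + s)) + (s + (p + q + r + s))) := by decide
  have z4 : ∀ p q r s : ZMod 2, refl (1, p + q + r) (1, s) =
    (1, p + (p + q + r + s) + (q + (p + q + r + s)) + (r + (p + q + r + s))) := by decide
  have z5 : ∀ p s w : ZMod 2, p + s = p + w + (s + w) := by decide
  funext k
  rw [chordMove, v0, vm, chordMove_chordMove_lineTuple hd hl y k,
    chordMove_chordMove_lineTuple hd hl x k]
  by_cases c1 : k = 0
  · rw [if_pos c1, if_pos c1, yl, ← z1]
  rw [if_neg c1, if_neg c1, if_neg c1]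
  by_cases c2 : k < 4 * d - 1
  · have yk := hy k
    rw [if_neg (by omega)] at yk
    rw [if_neg (by omega), if_pos (by omega), if_pos c2, if_pos c2, z2, yl, yk]
  rw [if_neg c2, if_neg c2]
  by_cases c3 : k = 4 * d - 1
  · rw [if_neg (by omega), if_pos (by omega), if_pos c3, if_pos c3, z3, y0, y2, yl]
  rw [if_neg c3, if_neg c3]
  by_cases c4 : k = 4 * d
  · rw [if_pos c4, if_pos c4, z4, y0, y1, y2]
  rw [if_neg c4, if_neg c4, if_neg c4, if_neg (by omega)]
  by_cases c5 : k < l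
  · have yk := hy k
    rw [if_neg (by omega)] at yk
    rw [if_pos c5, if_pos c5, y0, yl, yk, ← z5]
  rw [if_neg c5, if_neg c5]
  by_cases c6 : k = l
  · rw [if_pos c6, if_pos c6, y0, yl, ← z5]
  · have yk := hy k
    rw [if_neg (by omega)] at yk
    rw [if_neg c6, if_neg c6, yk]

theorem twistS_word_mem_formStabilizer {b d : ℕ} (hb : 1 ≤ b) (hd : 1 ≤ d) :
    (chordWord (numPts b d) (4 * d) (4 * d + 1) * chordWord (numPts b d) 1 (numPts b d)) *
      chordWord (numPts b d) 1 (4 * d + 1) *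
      (chordWord (numPts b d) (4 * d) (4 * d + 1) * chordWord (numPts b d) 1 (numPts b d))⁻¹ ∈
      formStabilizer b d := by
  have hn : 4 * d < numPts b d - 1 := by simp only [numPts]; omega
  refine mem_formStabilizer fun x => ⟨fun k =>
    if k = 0 ∨ k = 4 * d - 1 ∨ k = 4 * d ∨ k = numPts b d - 1 then
      x k + (x 0 + x (4 * d - 1) + x (4 * d) + x (numPts b d - 1)) else x k, ?_, ?_⟩
  · set y : ℕ → ZMod 2 := fun k =>
      if k = 0 ∨ k = 4 * d - 1 ∨ k = 4 * d ∨ k = numPts b d - 1 then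
        x k + (x 0 + x (4 * d - 1) + x (4 * d) + x (numPts b d - 1)) else x k with hy
    have hu : ∀ z : ℕ → ZMod 2, reflPullback (lineTuple d z)
        (chordWord (numPts b d) (4 * d) (4 * d + 1) * chordWord (numPts b d) 1 (numPts b d)) =
        chordMove 0 (numPts b d - 1) (chordMove (4 * d - 1) (4 * d) (lineTuple d z)) := by
      intro z
      rw [reflPullback_mul, reflPullback_chordWord' _ (by omega) (by omega) (by omega),
        reflPullback_chordWord' _ (by omega) (by omega) (by omega), Nat.add_sub_cancel]
    rw [reflPullback_mul, reflPullback_mul, hu,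
      reflPullback_chordWord' _ le_rfl (by omega) (by omega), Nat.add_sub_cancel, Nat.sub_self,
      chordMove_lineTuple_transvection hd hn x y (fun k => rfl), ← hu, reflPullback_mul_inv]
  · refine quadForm_eq_of_eqOn_compl b d {0, 4 * d - 1, 4 * d, numPts b d - 1} ?_ ?_ ?_
    · intro k hk
      simp only [Finset.mem_insert, Finset.mem_singleton] at hk
      rw [Finset.mem_range]
      omega
    · intro k hk
      simp only [Finset.mem_insert, Finset.mem_singleton] at hk
      exact if_neg hk
    · have w0 : weight b d 0 = 1 := if_neg (by omega)
      have w1 : weight b d (4 * d - 1) = 1 := if_neg (by omega)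
      have w2 : weight b d (4 * d) = 3 := if_pos (by omega)
      have w3 : weight b d (numPts b d - 1) = 1 := if_neg (by simp only [numPts]; omega)
      have h0 : 0 ∉ ({4 * d - 1, 4 * d, numPts b d - 1} : Finset ℕ) := by
        simp only [Finset.mem_insert, Finset.mem_singleton]; omega
      have h1 : 4 * d - 1 ∉ ({4 * d, numPts b d - 1} : Finset ℕ) := by
        simp only [Finset.mem_insert, Finset.mem_singleton]; omega
      rw [Finset.sum_insert h0, Finset.sum_insert h0, Finset.sum_insert h1, Finset.sum_insert h1,
        Finset.sum_pair (by omega), Finset.sum_pair (by omega), w0, w1, w2, w3]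
      simp only [true_or, or_true, if_true]
      generalize x 0 = p, x (4 * d - 1) = q, x (4 * d) = r, x (numPts b d - 1) = s
      revert p q r s
      decide

/-! ### The stabilized braid monodromy group preserves the form -/

theorem stabilizedMonodromyGroup_le {b d : ℕ} (hb : 1 ≤ b) (hd : 1 ≤ d) :
    stabilizedMonodromyGroup b d ≤
      (formStabilizer b d).map (PresentedGroup.mk (sphereBraidRels (numPts b d))) := by
  have hn : numPts b d = 4 * d + 4 * b := by simp only [numPts]; ring
  have adj : ∀ i j, j = i + 1 → 1 ≤ i → j ≤ numPts b d → posType d (i - 1) = posType d i →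
      weight b d (i - 1) = weight b d i → chordTwist (numPts b d) i j ∈
        (formStabilizer b d).map (PresentedGroup.mk (sphereBraidRels (numPts b d))) := by
    rintro i _ rfl h1 h2 h3 h4
    exact ⟨_, chordWord_mem_formStabilizer h1 h2 h3 h4, mk_chordWord _ _ _⟩
  have sq : ∀ i j, j = i + 1 → 1 ≤ i → j ≤ numPts b d → posType d (i - 1) = posType d i →
      chordTwist (numPts b d) i j ^ 2 ∈
        (formStabilizer b d).map (PresentedGroup.mk (sphereBraidRels (numPts b d))) := by
    rintro i _ rfl h1 h2 h3
    exact ⟨_, chordWord_sq_mem_formStabilizer h1 h2 h3, by rw [map_pow, mk_chordWord]⟩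
  have cube : ∀ i j, 1 ≤ i → i < j → j ≤ numPts b d → posType d (i - 1) ≠ posType d (j - 1) →
      chordTwist (numPts b d) i j ^ 3 ∈
        (formStabilizer b d).map (PresentedGroup.mk (sphereBraidRels (numPts b d))) := by
    intro i j h1 h2 h3 h4
    exact ⟨_, chordWord_cube_mem_formStabilizer h1 h2 h3 h4, by rw [map_pow, mk_chordWord]⟩
  have t0 : ∀ k, k < 4 * d → posType d k = 0 := fun k hk => if_pos hk
  have t1 : ∀ k, 4 * d ≤ k → posType d k = 1 := fun k hk => if_neg (by omega)
  have w1 : ∀ k, k < 4 * d ∨ 4 * d + 2 * b ≤ k → weight b d k = 1 :=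
    fun k hk => if_neg (by omega)
  have w3 : ∀ k, 4 * d ≤ k → k < 4 * d + 2 * b → weight b d k = 3 :=
    fun k hk hk' => if_pos ⟨hk, hk'⟩
  rw [stabilizedMonodromyGroup, Subgroup.closure_le]
  rintro _ (((⟨i, hi, hi', rfl | rfl⟩ | ⟨j, hj, hj', rfl | rfl⟩) | hx) | ⟨w, i, hw, rfl⟩)
  · refine adj _ _ ?_ ?_ ?_ ?_ ?_ <;> simp only [ptB']
    · omega
    · omega
    · omega
    · rw [t1 _ (by omega), t1 _ (by omega)]
    · rw [w3 _ (by omega) (by omega), w3 _ (by omega) (by omega)]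
  · refine adj _ _ ?_ ?_ ?_ ?_ ?_ <;> simp only [ptB'', hn]
    · omega
    · omega
    · omega
    · rw [t1 _ (by omega), t1 _ (by omega)]
    · rw [w1 _ (by omega), w1 _ (by omega)]
  · refine adj _ _ ?_ ?_ ?_ ?_ ?_ <;> simp only [ptD']
    · omega
    · omega
    · omega
    · rw [t0 _ (by omega), t0 _ (by omega)]
    · rw [w1 _ (by omega), w1 _ (by omega)]
  · refine adj _ _ ?_ ?_ ?_ ?_ ?_ <;> simp only [ptD'']
    · omega
    · omega
    · rw [t0 _ (by omega), t0 _ (by omega)]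
    · rw [w1 _ (by omega), w1 _ (by omega)]
  · rcases hx with rfl | rfl | rfl | rfl | rfl
    · refine sq _ _ ?_ ?_ ?_ ?_ <;> simp only [ptB', ptB'', hn]
      · omega
      · omega
      · omega
      · rw [t1 _ (by omega), t1 _ (by omega)]
    · refine sq _ _ ?_ ?_ ?_ ?_ <;> simp only [ptD', ptD'']
      · omega
      · omega
      · omega
      · rw [t0 _ (by omega), t0 _ (by omega)]
    · refine ⟨_, twistS_word_mem_formStabilizer hb hd, ?_⟩
      simp only [map_mul, map_inv, mk_chordWord, twistS, twistU', twistU'', twistU, ptD', ptB',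
        ptD'', ptB'', Nat.add_sub_cancel]
    · refine cube _ _ ?_ ?_ ?_ ?_ <;> simp only [ptD', ptB']
      · omega
      · omega
      · omega
      · rw [t0 _ (by omega), t1 _ (by omega)]
        decide
    · refine cube _ _ ?_ ?_ ?_ ?_ <;> simp only [ptD'', ptB'']
      · omega
      · omega
      · omega
      · rw [t0 _ (by omega), t1 _ (by omega)]
        decide
  · exact ⟨_, admissible_mem_formStabilizer w i hw, by
      rw [map_mul, map_mul, map_pow, map_inv]; rfl⟩

/-! ### Full twists on chords -/

/-- Words with the same value in the sphere braid group act in the same way on tuples with trivial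
product, up to an inner automorphism. -/
theorem exists_inner_of_mk_eq (hn : 1 ≤ n) {v w : FreeGroup (Fin (n - 1))}
    (h : PresentedGroup.mk (sphereBraidRels n) v = PresentedGroup.mk (sphereBraidRels n) w)
    (t : ℕ → ZMod 3 × M) (ht : tupleProd t n = 1) :
    ∃ g ∈ innerGroup M, ∀ k < n, reflPullback t w k = g (reflPullback t v k) := by
  have h1 : v⁻¹ * w ∈ Subgroup.normalClosure (sphereBraidRels n) := QuotientGroup.eq.mp h
  obtain ⟨g, hg, hk⟩ := actsInner_of_mem_normalClosure (M := M) hn h1 (reflPullback t v)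
    (by rw [tupleProd_reflPullback, ht])
  refine ⟨g, hg, fun k hkn => ?_⟩
  rw [← hk k hkn, ← reflPullback_mul, mul_inv_cancel_left]

/-- The class of a chord: `1` at its ends, `2` between them. -/
def chordClass (i j k : ℕ) : ℤ := if k = i ∨ k = j then 1 else if i < k ∧ k < j then 2 else 0

theorem chordMove_lineTuple {d i j : ℕ} (hij : i < j)
    (ht : ∀ k, i ≤ k → k ≤ j → posType d k = posType d i) (x : ℕ → ℤ) :
    chordMove i j (lineTuple d x) =
      lineTuple d fun k => x k + (x j - x i) * chordClass i j k := by
  funext k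
  simp only [chordMove, lineTuple, chordClass]
  rw [ht j hij.le le_rfl]
  by_cases h1 : k = i
  · subst h1
    simp
  · by_cases h2 : k = j
    · subst h2
      simp only [h1, if_false, if_true, or_true, refl_of_eq, ht k hij.le le_rfl]
      refine Prod.ext rfl ?_
      simp only [nsmul_eq_mul]
      push_cast
      ring
    · by_cases h3 : i < k ∧ k < j
      · simp only [h1, h2, h3, if_false, if_true, or_self, and_self, ht k h3.1.le h3.2.le,
          refl_of_eq]
        refine Prod.ext rfl ?_
        simp only [nsmul_eq_mul]
        push_cast
        ring
      · simp [h1, h2, h3]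

theorem reflPullback_chordWord_sq {d i j : ℕ} (hi : 1 ≤ i) (hij : i < j) (hj : j ≤ n)
    (ht : ∀ k, i - 1 ≤ k → k ≤ j - 1 → posType d k = posType d (i - 1)) (x : ℕ → ℤ) :
    reflPullback (lineTuple d x) (chordWord n i j ^ 2) =
      lineTuple d fun k =>
        x k + 2 * (x (j - 1) - x (i - 1)) * chordClass (i - 1) (j - 1) k := by
  rw [pow_two, reflPullback_mul, reflPullback_chordWord' _ hi hij hj,
    reflPullback_chordWord' _ hi hij hj, chordMove_lineTuple (by omega) ht,
    chordMove_lineTuple (by omega) ht]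
  congr 1
  funext k
  simp only [chordClass, true_or, or_true, if_true]
  ring

/-! ### A tuple with trivial product -/

theorem tupleProd_add_two_mul (t : ℕ → ZMod 3 × M) (a m : ℕ) (q : ZMod 3 × M)
    (h : ∀ k, a ≤ k → k < a + 2 * m → t k = q) : tupleProd t (a + 2 * m) = tupleProd t a := by
  induction m with
  | zero => rfl
  | succ m ih =>
    rw [show a + 2 * (m + 1) = a + 2 * m + 1 + 1 by ring, tupleProd, tupleProd,
      h _ (by omega) (by omega), h _ (by omega) (by omega), mul_assoc, reflPerm_mul_self, mul_one,
      ih fun k h1 h2 => h k h1 (by omega)]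

/-- The tuple whose coordinates are `1` at the points `D'_j` and `0` elsewhere. -/
def upperTuple (d k : ℕ) : ℤ := if 2 * d ≤ k ∧ k < 4 * d then 1 else 0

theorem tupleProd_upperTuple (b d : ℕ) :
    tupleProd (lineTuple d (upperTuple d)) (numPts b d) = 1 := by
  have hn : numPts b d = 0 + 2 * d + 2 * d + 2 * (2 * b) := by simp only [numPts]; ring
  rw [hn, tupleProd_add_two_mul _ _ _ (1, 0), tupleProd_add_two_mul _ _ _ (0, 1),
    tupleProd_add_two_mul _ _ _ (0, 0), tupleProd]
  · intro k h1 h2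
    simp only [lineTuple, posType, upperTuple]
    rw [if_pos (by omega), if_neg (by omega)]
  · intro k h1 h2
    simp only [lineTuple, posType, upperTuple]
    rw [if_pos (by omega), if_pos (by omega)]
  · intro k h1 h2
    simp only [lineTuple, posType, upperTuple]
    rw [if_neg (by omega), if_neg (by omega)]

/-! ### Values of the quadratic form -/

theorem quadForm_congr {b d : ℕ} {x y : ℕ → ZMod 2} (h : ∀ k < numPts b d, x k = y k) :
    quadForm b d x = quadForm b d y :=
  Finset.sum_congr rfl fun k hk => by rw [h k (Finset.mem_range.mp hk)]

theorem intCast_chordClass (i j k : ℕ) :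
    (chordClass i j k : ZMod 2) = if k = i ∨ k = j then 1 else 0 := by
  unfold chordClass
  split_ifs
  · simp
  · decide
  · simp

theorem quadForm_chordClass {b d i j : ℕ} (hij : i < j) (hj : j < 4 * d) :
    quadForm b d (fun k => (chordClass i j k : ZMod 2)) = 2 := by
  have hs : ({i, j} : Finset ℕ) ⊆ Finset.range (numPts b d) := by
    intro k hk
    simp only [Finset.mem_insert, Finset.mem_singleton] at hk
    rw [Finset.mem_range]
    simp only [numPts]
    omega
  rw [quadForm, ← Finset.sum_subset hs, Finset.sum_pair hij.ne]
  · simp only [intCast_chordClass, weight, true_or, or_true, if_true]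
    rw [if_neg (by omega), if_neg (by omega)]
    decide
  · intro k _ hk
    simp only [Finset.mem_insert, Finset.mem_singleton] at hk
    rw [intCast_chordClass, if_neg hk]
    simp

theorem quadForm_const (b d : ℕ) (p q : ZMod 2) :
    quadForm b d (fun k => if k < 4 * d then p else q) = 0 := by
  have hn : numPts b d = 4 * d + 2 * b + 2 * b := by simp only [numPts]; ring
  have h0 : ∀ k ∈ Finset.range (4 * d),
      weight b d k * (((if k < 4 * d then p else q : ZMod 2)).val : ZMod 4) = (p.val : ZMod 4) := by
    intro k hk
    have := Finset.mem_range.mp hk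
    rw [weight, if_neg (by omega), if_pos this, one_mul]
  have h1 : ∀ k ∈ Finset.range (2 * b), weight b d (4 * d + k) *
      (((if 4 * d + k < 4 * d then p else q : ZMod 2)).val : ZMod 4) = 3 * (q.val : ZMod 4) := by
    intro k hk
    have := Finset.mem_range.mp hk
    rw [weight, if_pos (by omega), if_neg (by omega)]
  have h2 : ∀ k ∈ Finset.range (2 * b), weight b d (4 * d + 2 * b + k) *
      (((if 4 * d + 2 * b + k < 4 * d then p else q : ZMod 2)).val : ZMod 4) =
        (q.val : ZMod 4) := by
    intro k hk
    rw [weight, if_neg (by omega), if_neg (by omega), one_mul]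
  rw [quadForm, hn, Finset.sum_range_add, Finset.sum_range_add, Finset.sum_congr rfl h0,
    Finset.sum_congr rfl h1, Finset.sum_congr rfl h2]
  simp only [Finset.sum_const, Finset.card_range, nsmul_eq_mul]
  have h4 : (4 : ZMod 4) = 0 := rfl
  push_cast
  linear_combination ((d : ZMod 4) * p.val + 2 * b * q.val) * h4

theorem quadForm_chordClass_add_const {b d i j : ℕ} (hi : 4 * d ≤ i) (hi' : i < 4 * d + 2 * b)
    (hj : 4 * d + 2 * b ≤ j) (hj' : j < numPts b d) (l p q : ZMod 2) :
    quadForm b d (fun k => l * (chordClass i j k : ZMod 2) + if k < 4 * d then p else q) = 0 := by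
  rw [← quadForm_const b d p q]
  refine quadForm_eq_of_eqOn_compl b d {i, j} ?_ ?_ ?_
  · intro k hk
    simp only [Finset.mem_insert, Finset.mem_singleton] at hk
    rw [Finset.mem_range]
    omega
  · intro k hk
    simp only [Finset.mem_insert, Finset.mem_singleton] at hk
    simp only [intCast_chordClass, if_neg hk, mul_zero, zero_add]
  · rw [Finset.sum_pair (by omega), Finset.sum_pair (by omega)]
    simp only [intCast_chordClass, weight, true_or, or_true, if_true]
    rw [if_pos (by omega), if_neg (by omega), if_neg (by omega), if_neg (by omega)]
    revert l q
    decide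

/-! ### The full twists on `p_i` and `q_j` are not conjugate -/

theorem twistP_sq_not_conj_twistQ_sq {b d : ℕ} (hb : 1 ≤ b) (hd : 1 ≤ d) {i j : ℕ} (hi : 1 ≤ i)
    (hi' : i ≤ 2 * b) (hj : 1 ≤ j) (hj' : j ≤ 2 * d) {h : SphereBraid (numPts b d)}
    (hh : h ∈ stabilizedMonodromyGroup b d) : h * twistP b d i ^ 2 ≠ twistQ b d j ^ 2 * h := by
  intro heq
  have hn : numPts b d = 4 * d + 4 * b := by simp only [numPts]; ring
  obtain ⟨w, hw, rfl⟩ := stabilizedMonodromyGroup_le hb hd hh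
  have t0 : ∀ k, k < 4 * d → posType d k = 0 := fun k hk => if_pos hk
  have t1 : ∀ k, 4 * d ≤ k → posType d k = 1 := fun k hk => if_neg (by omega)
  rw [twistP, twistQ, ← mk_chordWord, ← mk_chordWord, ← map_pow, ← map_pow, ← map_mul,
    ← map_mul] at heq
  obtain ⟨g, hg, hgk⟩ := exists_inner_of_mk_eq (M := ℤ) (by omega) heq
    (lineTuple d (upperTuple d)) (tupleProd_upperTuple b d)
  set v := chordClass (ptD'' j - 1) (ptD' d j - 1) with hv
  set v' := chordClass (ptB' d i - 1) (ptB'' b d i - 1)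
  obtain ⟨z, hz⟩ := exists_lineTuple hw (fun k => ((upperTuple d k, v k) : ℤ × ℤ))
  have hz1 : ∀ f : ℤ × ℤ →+ ℤ, reflPullback (lineTuple d fun k => f (upperTuple d k, v k)) w =
      lineTuple d fun k => f (z k) := by
    intro f
    have := reflPullback_map f (lineTuple d fun k => ((upperTuple d k, v k) : ℤ × ℤ)) w
    rw [hz] at this
    exact this
  have hQ : reflPullback (lineTuple d (upperTuple d))
      (chordWord (numPts b d) (ptD'' j) (ptD' d j) ^ 2 * w) =
      lineTuple d fun k => (z k).1 + 2 * (z k).2 := by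
    rw [reflPullback_mul, reflPullback_chordWord_sq]
    · have h1 : upperTuple d (ptD' d j - 1) - upperTuple d (ptD'' j - 1) = 1 := by
        have h2 : upperTuple d (ptD' d j - 1) = 1 := if_pos (by simp only [ptD']; omega)
        have h3 : upperTuple d (ptD'' j - 1) = 0 := if_neg (by simp only [ptD'']; omega)
        rw [h2, h3, sub_zero]
      rw [h1]
      have := hz1 (AddMonoidHom.fst ℤ ℤ + 2 • AddMonoidHom.snd ℤ ℤ)
      simpa using this
    · exact hj
    · simp only [ptD', ptD'']; omega
    · simp only [ptD', hn]; omega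
    · intro k h1 h2
      simp only [ptD', ptD''] at h1 h2 ⊢
      rw [t0 _ (by omega), t0 _ (by omega)]
  have hP : reflPullback (lineTuple d (upperTuple d))
      (w * chordWord (numPts b d) (ptB' d i) (ptB'' b d i) ^ 2) =
      lineTuple d fun k => (z k).1 +
        2 * ((z (ptB'' b d i - 1)).1 - (z (ptB' d i - 1)).1) * v' k := by
    rw [reflPullback_mul]
    have h1 : reflPullback (lineTuple d (upperTuple d)) w = lineTuple d fun k => (z k).1 :=
      hz1 (AddMonoidHom.fst ℤ ℤ)
    rw [h1, reflPullback_chordWord_sq]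
    · simp only [ptB']; omega
    · simp only [ptB', ptB'', hn]; omega
    · simp only [ptB'', hn]; omega
    · intro k h1 h2
      simp only [ptB', ptB''] at h1 h2 ⊢
      rw [t1 _ (by omega), t1 _ (by omega)]
  rw [hQ, hP] at hgk
  set l := (z (ptB'' b d i - 1)).1 - (z (ptB' d i - 1)).1
  obtain ⟨η, hη, κ, m, hgm⟩ := innerGroup_affine hg
  have hgk' : ∀ k < numPts b d, posType d k = η * posType d k + κ ∧
      (z k).1 + 2 * (z k).2 = η * ((z k).1 + 2 * l * v' k) + m (posType d k) := by
    intro k hk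
    have h1 := hgk k hk
    simp only [lineTuple, hgm] at h1
    exact Prod.ext_iff.mp h1
  have hκ : κ = 0 := by
    have h1 := (hgk' 0 (by omega)).1
    rw [t0 0 (by omega)] at h1
    simpa using h1.symm
  have hη1 : η = 1 := by
    rcases hη with h1 | h1
    · exact h1
    · have h2 := (hgk' (4 * d) (by omega)).1
      rw [t1 _ le_rfl, hκ, h1] at h2
      exact absurd h2 (by decide)
  subst hη1
  have hmod : ∀ k < numPts b d, ((z k).2 : ZMod 2) = (l : ZMod 2) * (v' k : ZMod 2) +
      if k < 4 * d then (((z 0).2 - l * v' 0 : ℤ) : ZMod 2)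
      else (((z (4 * d)).2 - l * v' (4 * d) : ℤ) : ZMod 2) := by
    intro k hk
    have h1 := (hgk' k hk).2
    split_ifs with h2
    · have h3 := (hgk' 0 (by omega)).2
      rw [t0 _ h2] at h1
      rw [t0 _ (by omega)] at h3
      have h4 : (z k).2 = l * v' k + ((z 0).2 - l * v' 0) := by linarith
      rw [h4]
      push_cast
      ring
    · have h3 := (hgk' (4 * d) (by omega)).2
      rw [t1 _ (by omega)] at h1
      rw [t1 _ le_rfl] at h3
      have h4 : (z k).2 = l * v' k + ((z (4 * d)).2 - l * v' (4 * d)) := by linarith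
      rw [h4]
      push_cast
      ring
  have hform : quadForm b d (fun k => ((z k).2 : ZMod 2)) =
      quadForm b d (fun k => (v k : ZMod 2)) := by
    refine hw.2 _ _ ?_
    have := reflPullback_map ((Int.castAddHom (ZMod 2)).comp (AddMonoidHom.snd ℤ ℤ))
      (lineTuple d fun k => ((upperTuple d k, v k) : ℤ × ℤ)) w
    rw [hz] at this
    exact this
  rw [quadForm_congr hmod, quadForm_chordClass_add_const, hv, quadForm_chordClass] at hform
  · exact absurd hform (by decide)
  · simp only [ptD', ptD'']; omega
  · simp only [ptD']; omega
  · simp only [ptB']; omega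
  · simp only [ptB']; omega
  · simp only [ptB'', hn]; omega
  · simp only [ptB'', hn]; omega

end BidoubleBraid

theorem mainTheorem4 (b d : ℕ) (hb : 3 ≤ b) (hd : 3 ≤ d)
    (i j : ℕ) (hi : 1 ≤ i) (hi' : i ≤ 2 * b) (hj : 1 ≤ j) (hj' : j ≤ 2 * d) :
    (¬ ∃ h ∈ BidoubleBraid.stabilizedMonodromyGroup b d,
      h * BidoubleBraid.twistP b d i = BidoubleBraid.twistQ b d j * h) ∧
    (¬ ∃ h ∈ BidoubleBraid.monodromyGroup b d,
      h * BidoubleBraid.twistP b d i ^ 2 * h⁻¹ = BidoubleBraid.twistQ b d j ^ 2) ∧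
    (¬ ∃ h ∈ BidoubleBraid.stabilizedMonodromyGroup b d,
      h * BidoubleBraid.twistP b d i ^ 2 * h⁻¹ = BidoubleBraid.twistQ b d j ^ 2) := by
  have key : ∀ h ∈ BidoubleBraid.stabilizedMonodromyGroup b d,
      h * BidoubleBraid.twistP b d i ^ 2 ≠ BidoubleBraid.twistQ b d j ^ 2 * h := fun h hh =>
    BidoubleBraid.twistP_sq_not_conj_twistQ_sq (by omega) (by omega) hi hi' hj hj' hh
  refine ⟨?_, ?_, ?_⟩
  · rintro ⟨h, hh, heq⟩
    refine key h hh ?_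
    rw [pow_two, pow_two, ← mul_assoc, heq, mul_assoc, heq, mul_assoc]
  · rintro ⟨h, hh, heq⟩
    exact key h (Subgroup.closure_mono Set.subset_union_left hh) (mul_inv_eq_iff_eq_mul.mp heq)
  · rintro ⟨h, hh, heq⟩
    exact key h hh (mul_inv_eq_iff_eq_mul.mp heq)
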